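/- A distribution over $[n]=\{1,\dots,n\}$ is accessed through a conditional sampling oracle: given a nonempty set $A\subseteq[n]$, the oracle returns an element $j\in A$ drawn according to $\mu$ conditioned on $A$ (if $\mu(A)=0$, a uniformly random element of $A$), independently of all previous samples. A property $\mathcal P$ is, for every $n$, a set of distributions over $[n]$; it is label-invariant if it is closed under permutations of $[n]$. A distribution $\mu$ over $[n]$ is $\epsilon$-far from $\mathcal P$ if $\frac12\sum_{i=1}^n|\mu(i)-\mu'(i)|\ge\epsilon$ for every distribution $\mu'$ over $[n]$ in $\mathcal P$. An adaptive tester for $\mathcal P$ with conditional sample complexity $t(\epsilon,\delta,n)$ is a randomized algorithm that, given $\epsilon,\delta>0$, $n\ge1$ and the conditional sampling oracle of an unknown distribution $\mu$ over $[n]$, submits $t(\epsilon,\delta,n)$ nonempty sets one after another, each chosen on the basis of the previously received elements and of its internal coin tosses, and then accepts or rejects on the basis of the received elements and its coin tosses. It must accept with probability at least $1-\delta$ if $\mu$ satisfies $\mathcal P$, and reject with probability at least $1-\delta$ if $\mu$ is $\epsilon$-far from $\mathcal P$. (Only the number of samples is bounded; the algorithm's computation is unrestricted.) **Theorem.** There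 is a polynomial $p$ in three variables such that every label-invariant property $\mathcal P$ of distributions has an adaptive tester whose conditional sample complexity satisfies $t(\epsilon,\delta,n)\le p(\log n,\epsilon^{-1},\log(\delta^{-1}))$ for all $\epsilon,\delta>0$ and all $n\ge1$. -/

import Mathlib

noncomputable section

namespace CondTesting

/-- The variation distance `½ ∑ᵢ |μ(i) - ν(i)|` of two distributions over an `n`-element domain. -/
def tvDist {n : ℕ} (μ ν : PMF (Fin n)) : ℝ :=
  (1 / 2) * ∑ i, |(μ i).toReal - (ν i).toReal|

/-- A property of distributions: for every `n`, a set of distributions over `[n]`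
(the domain `[n]` is represented by `Fin n`). -/
abbrev DistProperty : Type := (n : ℕ) → Set (PMF (Fin n))

/-- Invariance under all permutations of the domain (`μ.map σ` is the image of `μ` under `σ`). -/
def IsLabelInvariant (P : DistProperty) : Prop :=
  ∀ (n : ℕ) (σ : Equiv.Perm (Fin n)) (μ : PMF (Fin n)), μ ∈ P n → μ.map σ ∈ P n

/-- `μ` is `ε`-far from the property: it has distance at least `ε` from all its members. -/
def IsFar {n : ℕ} (ε : ℝ) (μ : PMF (Fin n)) (S : Set (PMF (Fin n))) : Prop :=
  ∀ ν ∈ S, ε ≤ tvDist μ ν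

open Classical in
/-- The answer of the conditional sampling oracle to a nonempty set `A`: a sample of `μ`
conditioned on `A`, and a uniformly drawn member of `A` if `μ(A) = 0`. -/
def condSample {n : ℕ} (μ : PMF (Fin n)) (A : {A : Finset (Fin n) // A.Nonempty}) :
    PMF (Fin n) :=
  if h : ∃ a ∈ (A.1 : Set (Fin n)), a ∈ μ.support then μ.filter (A.1 : Set (Fin n)) h
  else PMF.uniformOfFinset A.1 A.2

/-- An adaptive randomized algorithm with conditional sample access to a distribution over `[n]`.
Its internal coin tosses are a random seed; the next set to condition on is a function of the seed
and of the list of the elements received so far (in the order of their arrival), and so is the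
final decision (`true` means that the algorithm accepts). -/
structure AdaptiveAlgorithm (n : ℕ) where
  Seed : Type
  coins : PMF Seed
  query : Seed → List (Fin n) → {A : Finset (Fin n) // A.Nonempty}
  decide : Seed → List (Fin n) → Bool

/-- The law of the list of the first `t` received elements, for a given seed: every element is
drawn by the oracle independently of the earlier ones, given the set that was submitted. -/
def AdaptiveAlgorithm.transcript {n : ℕ} (T : AdaptiveAlgorithm n) (μ : PMF (Fin n))
    (r : T.Seed) : ℕ → PMF (List (Fin n))
  | 0 => PMF.pure []
  | t + 1 => (T.transcript μ r t).bind fun h =>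
      (condSample μ (T.query r h)).map fun j => h ++ [j]

/-- The law of the decision of the algorithm after taking exactly `t` conditional samples. -/
def AdaptiveAlgorithm.output {n : ℕ} (T : AdaptiveAlgorithm n) (μ : PMF (Fin n)) (t : ℕ) :
    PMF Bool :=
  T.coins.bind fun r => (T.transcript μ r t).map (T.decide r)

/-- There is an adaptive tester for `P` with conditional sample complexity `t`: for given
`ε, δ > 0` and `n ≥ 1` it takes `t ε δ n` adaptive conditional samples, and with probability at
least `1 - δ` it accepts if `μ` satisfies `P` and rejects if `μ` is `ε`-far from `P`. -/
def HasAdaptiveTester (P : DistProperty) (t : ℝ → ℝ → ℕ → ℕ) : Prop :=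
  ∀ (ε δ : ℝ) (n : ℕ), 0 < ε → 0 < δ → 1 ≤ n →
    ∃ T : AdaptiveAlgorithm n, ∀ μ : PMF (Fin n),
      (μ ∈ P n → 1 - δ ≤ (T.output μ (t ε δ n) true).toReal) ∧
      (IsFar ε μ (P n) → 1 - δ ≤ (T.output μ (t ε δ n) false).toReal)

end CondTesting

end

noncomputable section

namespace CondTesting

open scoped ENNReal

/-! ### Query programs -/

/-! Up to relabelling, a distribution is determined by how its mass is spread over the values `μ i`.
So it suffices to draw `i` from `μ`, attach a rough value of `log (μ i)` to it, and learn the law of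
this label.

The value `μ i` is the product, along the dyadic blocks around `i`, of the conditional probabilities
of a block in its parent. Each factor is estimated by conditional samples from the parent. This is
cheap only if no factor is tiny, and a random `i` rarely meets a tiny one: the inverse factor has
mean at most 2 on each level (`sum_mul_blockMass_div_le`, `toOuterMeasure_not_heavyPath_le`). Then
`estimate_error` controls the logarithm of the product, and rounding leaves polynomially many
labels.

The label law need not be ideal: it is a function of the distribution, so the tester can compute it
for every candidate `ν`. It accepts iff some member of the property has a label law near the
observed frequencies. If so, `μ` and `ν` have close label laws; matching elements through equal
labels couples elements of nearly equal probability (`exists_perm_tvDist_le_of_labels`), and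
Birkhoff's theorem turns the coupling into a permutation (`exists_perm_tvDist_le`). Label invariance
then shows that `μ` is not far. -/

/-- Decision trees whose inner nodes are conditional sampling queries and whose leaves carry
a result. -/
inductive QueryTree (n : ℕ) (α : Type) : Type
  | ret (a : α) : QueryTree n α
  | ask (A : {A : Finset (Fin n) // A.Nonempty}) (k : Fin n → QueryTree n α) : QueryTree n α

namespace QueryTree

variable {n : ℕ} {α β : Type}

/-- Continue with another tree at every leaf. -/
def bind : QueryTree n α → (α → QueryTree n β) → QueryTree n β
  | ret a, f => f a
  | ask A k, f => ask A fun j => (k j).bind f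

/-- The law of the result when the queries are answered by the oracle of `μ`. -/
def law (μ : PMF (Fin n)) : QueryTree n α → PMF α
  | ret a => PMF.pure a
  | ask A k => (condSample μ A).bind fun j => (k j).law μ

/-- No branch of the tree makes more than `t` queries. -/
def DepthLE : QueryTree n α → ℕ → Prop
  | ret _, _ => True
  | ask _ _, 0 => False
  | ask _ k, t + 1 => ∀ j, (k j).DepthLE t

/-- Run a tree `s` times and list the results. -/
def replicate (p : QueryTree n α) : ℕ → QueryTree n (List α)
  | 0 => ret []
  | s + 1 => p.bind fun a => (p.replicate s).bind fun l => ret (a :: l)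

@[simp] lemma law_ret (μ : PMF (Fin n)) (a : α) : (ret a : QueryTree n α).law μ = PMF.pure a := rfl

lemma law_bind (μ : PMF (Fin n)) (p : QueryTree n α) (f : α → QueryTree n β) :
    (p.bind f).law μ = (p.law μ).bind fun a => (f a).law μ := by
  induction p with
  | ret a => simp [bind, law]
  | ask A k ih => simp [bind, law, ih, PMF.bind_bind]

lemma depthLE_ret (a : α) (t : ℕ) : (ret a : QueryTree n α).DepthLE t := trivial

lemma DepthLE.mono {p : QueryTree n α} {s t : ℕ} (h : p.DepthLE s) (hst : s ≤ t) :
    p.DepthLE t := by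
  induction p generalizing s t with
  | ret a => trivial
  | ask A k ih =>
    cases s with
    | zero => exact h.elim
    | succ s =>
      obtain ⟨t, rfl⟩ : ∃ u, t = u + 1 := ⟨t - 1, by omega⟩
      exact fun j => ih j (h j) (by omega)

lemma DepthLE.bind {p : QueryTree n α} {f : α → QueryTree n β} {s t : ℕ} (h : p.DepthLE s)
    (hf : ∀ a, (f a).DepthLE t) : (p.bind f).DepthLE (s + t) := by
  induction p generalizing s with
  | ret a => exact (hf a).mono (by omega)
  | ask A k ih =>
    cases s with
    | zero => exact h.elim
    | succ s =>
      rw [show s + 1 + t = (s + t) + 1 by omega]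
      exact fun j => ih j (h j)

lemma DepthLE.replicate {p : QueryTree n α} {t : ℕ} (h : p.DepthLE t) (s : ℕ) :
    (p.replicate s).DepthLE (s * t) := by
  induction s with
  | zero => trivial
  | succ s ih =>
    rw [show (s + 1) * t = t + (s * t + 0) by ring]
    exact h.bind fun a => ih.bind fun l => trivial

/-- The subtree reached when the next query is answered with `j`. -/
def next : QueryTree n α → Fin n → QueryTree n α
  | ret a, _ => ret a
  | ask _ k, j => k j

/-- The set queried at the root, and `A₀` at a leaf. -/
def rootQuery (A₀ : {A : Finset (Fin n) // A.Nonempty}) :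
    QueryTree n α → {A : Finset (Fin n) // A.Nonempty}
  | ret _ => A₀
  | ask A _ => A

/-- The value at a leaf, and `a₀` at an inner node. -/
def leafValue (a₀ : α) : QueryTree n α → α
  | ret a => a
  | ask _ _ => a₀

/-- The algorithm that walks down a query tree. -/
def toAlgorithm (A₀ : {A : Finset (Fin n) // A.Nonempty}) (p : QueryTree n Bool) :
    AdaptiveAlgorithm n where
  Seed := Unit
  coins := PMF.pure ()
  query _ h := rootQuery A₀ (h.foldl next p)
  decide _ h := leafValue false (h.foldl next p)

/-- One step of the walk down a query tree. -/
def step (A₀ : {A : Finset (Fin n) // A.Nonempty}) (μ : PMF (Fin n)) (p : QueryTree n α) :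
    PMF (QueryTree n α) :=
  (condSample μ (rootQuery A₀ p)).map p.next

/-- `t` steps of the walk down a query tree. -/
def walk (A₀ : {A : Finset (Fin n) // A.Nonempty}) (μ : PMF (Fin n)) (p : QueryTree n α) :
    ℕ → PMF (QueryTree n α)
  | 0 => PMF.pure p
  | t + 1 => (walk A₀ μ p t).bind (step A₀ μ)

/-- Transcripts grow at the end while trees recurse from the root; peeling off the first step
reconciles the two. -/
lemma walk_succ' (A₀ : {A : Finset (Fin n) // A.Nonempty}) (μ : PMF (Fin n))
    (p : QueryTree n α) (t : ℕ) :
    walk A₀ μ p (t + 1) = (step A₀ μ p).bind fun q => walk A₀ μ q t := by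
  induction t with
  | zero => simp [walk]
  | succ t ih => rw [walk, ih, PMF.bind_bind]; rfl

lemma walk_ret (A₀ : {A : Finset (Fin n) // A.Nonempty}) (μ : PMF (Fin n)) (a : α) (t : ℕ) :
    walk A₀ μ (ret a) t = PMF.pure (ret a) := by
  induction t with
  | zero => rfl
  | succ t ih =>
    rw [walk, ih, PMF.pure_bind, step]
    exact PMF.map_const _ _

/-- Leaves are absorbing, so branches that end early can be padded with dummy queries to `A₀` to
reach exactly `t` samples. -/
lemma walk_of_depthLE (A₀ : {A : Finset (Fin n) // A.Nonempty}) (μ : PMF (Fin n))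
    {p : QueryTree n α} {t : ℕ} (h : p.DepthLE t) : walk A₀ μ p t = (p.law μ).map ret := by
  induction p generalizing t with
  | ret a => rw [walk_ret, law_ret, PMF.pure_map]
  | ask A k ih =>
    cases t with
    | zero => exact h.elim
    | succ t =>
      rw [walk_succ', step, PMF.bind_map, law, PMF.map_bind]
      exact congrArg _ (funext fun j => ih j (h j))

lemma transcript_map_foldl (A₀ : {A : Finset (Fin n) // A.Nonempty}) (μ : PMF (Fin n))
    (p : QueryTree n Bool) (t : ℕ) :
    ((p.toAlgorithm A₀).transcript μ () t).map (List.foldl next p) = walk A₀ μ p t := by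
  induction t with
  | zero => simp [AdaptiveAlgorithm.transcript, walk, PMF.pure_map]
  | succ t ih =>
    have h : (p.toAlgorithm A₀).transcript μ () (t + 1) =
        ((p.toAlgorithm A₀).transcript μ () t).bind fun h =>
          (condSample μ (rootQuery A₀ (h.foldl next p))).map fun j => h ++ [j] := rfl
    rw [walk, ← ih, PMF.bind_map, h, PMF.map_bind]
    refine congrArg _ (funext fun h => ?_)
    rw [PMF.map_comp, Function.comp_apply, step]
    congr 1
    funext j
    simp

/-- The algorithm of a query tree decides as the tree does. -/
lemma output_toAlgorithm (A₀ : {A : Finset (Fin n) // A.Nonempty}) (μ : PMF (Fin n))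
    {p : QueryTree n Bool} {t : ℕ} (h : p.DepthLE t) :
    (p.toAlgorithm A₀).output μ t = p.law μ := by
  have key : ((p.toAlgorithm A₀).transcript μ () t).map ((p.toAlgorithm A₀).decide ()) =
      p.law μ := by
    have : (p.toAlgorithm A₀).decide () = leafValue false ∘ List.foldl next p := rfl
    rw [this, ← PMF.map_comp, transcript_map_foldl, walk_of_depthLE A₀ μ h, PMF.map_comp]
    exact PMF.map_id _
  exact (PMF.pure_bind _ _).trans key

end QueryTree

/-! ### Independent samples and concentration -/

section Concentration

variable {α β : Type}

/-- The law of a list of `s` independent samples. -/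
def iidList (q : PMF α) : ℕ → PMF (List α)
  | 0 => PMF.pure []
  | s + 1 => q.bind fun a => (iidList q s).map (a :: ·)

lemma QueryTree.law_replicate {n : ℕ} (μ : PMF (Fin n)) (p : QueryTree n α) (s : ℕ) :
    (p.replicate s).law μ = iidList (p.law μ) s := by
  induction s with
  | zero => rfl
  | succ s ih =>
    simp only [QueryTree.replicate, law_bind, ih, iidList, law_ret]
    rfl

lemma toOuterMeasure_le_one (q : PMF α) (S : Set α) : q.toOuterMeasure S ≤ 1 := by
  rw [PMF.toOuterMeasure_apply]
  calc _ ≤ ∑' a, q a := ENNReal.tsum_le_tsum fun a => Set.indicator_le_self _ _ _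
    _ = 1 := q.tsum_coe

lemma one_sub_toOuterMeasure_compl_le (q : PMF α) (S : Set α) :
    1 - q.toOuterMeasure Sᶜ ≤ q.toOuterMeasure S := by
  rw [tsub_le_iff_right]
  have h1 : q.toOuterMeasure Set.univ = 1 :=
    (q.toOuterMeasure_apply_eq_one_iff _).2 (Set.subset_univ _)
  rw [← h1, ← Set.union_compl_self S]
  exact MeasureTheory.measure_union_le _ _

/-- The union bound for two-stage experiments: either the first stage leaves `G`, or the second
fails from a point of `G`. -/
lemma toOuterMeasure_bind_le (q : PMF α) (f : α → PMF β) (S : Set β) (G : Set α) (c : ℝ≥0∞)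
    (h : ∀ a ∈ G, (f a).toOuterMeasure S ≤ c) :
    (q.bind f).toOuterMeasure S ≤ q.toOuterMeasure Gᶜ + c := by
  classical
  rw [PMF.toOuterMeasure_bind_apply, PMF.toOuterMeasure_apply]
  calc ∑' a, q a * (f a).toOuterMeasure S
      ≤ ∑' a, (Gᶜ.indicator q a + q a * c) := by
        refine ENNReal.tsum_le_tsum fun a => ?_
        by_cases ha : a ∈ G
        · exact (mul_le_mul_right (h a ha) _).trans le_add_self
        · rw [Set.indicator_of_mem (show a ∈ Gᶜ from ha)]
          exact (mul_le_of_le_one_right' (toOuterMeasure_le_one _ _)).trans le_self_add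
    _ = _ := by rw [ENNReal.tsum_add, ENNReal.tsum_mul_right, q.tsum_coe, one_mul]

lemma sum_toReal_eq_one [Fintype α] (q : PMF α) : ∑ a, (q a).toReal = 1 := by
  rw [← ENNReal.toReal_sum fun a _ => q.apply_ne_top a, ← tsum_fintype (L := .unconditional _),
    q.tsum_coe, ENNReal.toReal_one]

/-- The exponential moment bound behind the Chernoff inequality. -/
lemma sum_mul_exp_le [Fintype α] (q : PMF α) (X : α → ℝ) (hX : ∀ a, |X a| ≤ 1) {r : ℝ}
    (hr : |r| ≤ 1) :
    ∑ a, (q a).toReal * Real.exp (r * X a) ≤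
      Real.exp (r * ∑ a, (q a).toReal * X a + r ^ 2) := by
  calc ∑ a, (q a).toReal * Real.exp (r * X a)
      ≤ ∑ a, (q a).toReal * (1 + r * X a + r ^ 2) := by
        refine Finset.sum_le_sum fun a _ => mul_le_mul_of_nonneg_left ?_ ENNReal.toReal_nonneg
        have h1 : |r * X a| ≤ 1 := by
          rw [abs_mul]; exact mul_le_one₀ hr (abs_nonneg _) (hX a)
        have h2 := (abs_le.1 (Real.abs_exp_sub_one_sub_id_le h1)).2
        have h3 : (r * X a) ^ 2 ≤ r ^ 2 := by
          rw [mul_pow]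
          exact mul_le_of_le_one_right (sq_nonneg _) ((sq_le_one_iff_abs_le_one _).2 (hX a))
        linarith
    _ = r * ∑ a, (q a).toReal * X a + r ^ 2 + 1 := by
        simp only [mul_add, Finset.sum_add_distrib, mul_one, sum_toReal_eq_one, Finset.mul_sum,
          ← Finset.sum_mul, one_mul]
        rw [add_comm (1 : ℝ), add_right_comm]
        congr 2
        exact Finset.sum_congr rfl fun a _ => by ring
    _ ≤ _ := Real.add_one_le_exp _

/-- The exponential Markov inequality, run inside the induction: peeling off a first sample `a`
shifts the threshold to `c - X a`, and averaging over `a` yields one more moment factor. -/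
lemma iidList_toOuterMeasure_le [Fintype α] (q : PMF α) (X : α → ℝ) (hX : ∀ a, |X a| ≤ 1)
    {r : ℝ} (hr0 : 0 ≤ r) (hr : r ≤ 1) (s : ℕ) (c : ℝ) :
    (iidList q s).toOuterMeasure {l | c ≤ (l.map X).sum} ≤
      ENNReal.ofReal
        (Real.exp (-(r * c)) * Real.exp (r * ∑ a, (q a).toReal * X a + r ^ 2) ^ s) := by
  induction s generalizing c with
  | zero =>
    rw [iidList, PMF.toOuterMeasure_pure_apply]
    split_ifs with h
    · simp only [Set.mem_ofPred_eq, List.map_nil, List.sum_nil] at h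
      rw [← ENNReal.ofReal_one]
      refine ENNReal.ofReal_le_ofReal ?_
      rw [pow_zero, mul_one]
      exact Real.one_le_exp (by nlinarith)
    · exact zero_le
  | succ s ih =>
    rw [iidList, PMF.toOuterMeasure_bind_apply, tsum_fintype]
    set B := Real.exp (r * ∑ a, (q a).toReal * X a + r ^ 2)
    calc _ ≤ ∑ a, ENNReal.ofReal
          ((q a).toReal * (Real.exp (-(r * (c - X a))) * B ^ s)) := by
          refine Finset.sum_le_sum fun a _ => ?_
          rw [ENNReal.ofReal_mul ENNReal.toReal_nonneg, ENNReal.ofReal_toReal (q.apply_ne_top a),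
            PMF.toOuterMeasure_map_apply]
          refine mul_le_mul_right ?_ _
          refine le_of_eq_of_le (congrArg _ (Set.ext fun l => ?_)) (ih (c - X a))
          simp [add_comm]
      _ = ENNReal.ofReal (Real.exp (-(r * c)) * B ^ s *
            ∑ a, (q a).toReal * Real.exp (r * X a)) := by
          rw [← ENNReal.ofReal_sum_of_nonneg fun a _ => by positivity, Finset.mul_sum]
          congr 1
          refine Finset.sum_congr rfl fun a _ => ?_
          rw [show -(r * (c - X a)) = -(r * c) + r * X a by ring, Real.exp_add]
          ring
      _ ≤ _ := by
          refine ENNReal.ofReal_le_ofReal ?_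
          rw [pow_succ, ← mul_assoc]
          exact mul_le_mul_of_nonneg_left
            (sum_mul_exp_le q X hX (abs_le.2 ⟨by linarith, hr⟩)) (by positivity)

/-- A Chernoff bound for the sum of independent samples of a bounded function. -/
lemma iidList_toOuterMeasure_mean_add_le [Fintype α] (q : PMF α) (X : α → ℝ)
    (hX : ∀ a, |X a| ≤ 1) {τ : ℝ} (hτ0 : 0 ≤ τ) (hτ : τ ≤ 1) (s : ℕ) :
    (iidList q s).toOuterMeasure
        {l | s * (∑ a, (q a).toReal * X a + τ) ≤ (l.map X).sum} ≤
      ENNReal.ofReal (Real.exp (-(s * τ ^ 2 / 4))) := by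
  -- The exponent per sample is `r ^ 2 - r * τ`, smallest at `r = τ / 2`.
  refine (iidList_toOuterMeasure_le q X hX (r := τ / 2) (by linarith) (by linarith) s _).trans
    (ENNReal.ofReal_le_ofReal (le_of_eq ?_))
  rw [← Real.exp_nat_mul, ← Real.exp_add]
  congr 1
  ring

open Classical in
lemma sum_toReal_mul_ite [Fintype α] (q : PMF α) (S : Set α) :
    ∑ a, (q a).toReal * (if a ∈ S then 1 else 0) = (q.toOuterMeasure S).toReal := by
  rw [PMF.toOuterMeasure_apply_fintype, ENNReal.toReal_sum]
  · refine Finset.sum_congr rfl fun a _ => ?_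
    by_cases h : a ∈ S <;> simp [h]
  · intro a _
    by_cases h : a ∈ S <;> simp [h, q.apply_ne_top]

open Classical in
/-- The share of the members of a list that lie in `S`. -/
def freq (S : Set α) (s : ℕ) (l : List α) : ℝ :=
  (l.map fun a => if a ∈ S then (1 : ℝ) else 0).sum / s

/-- The frequency of an event among independent samples is close to its probability. -/
lemma iidList_freq_le [Fintype α] (q : PMF α) (S : Set α) {τ : ℝ} (hτ0 : 0 ≤ τ) (hτ : τ ≤ 1)
    {s : ℕ} (hs : 0 < s) :
    (iidList q s).toOuterMeasure {l | ¬ |freq S s l - (q.toOuterMeasure S).toReal| ≤ τ} ≤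
      ENNReal.ofReal (2 * Real.exp (-(s * τ ^ 2 / 4))) := by
  classical
  have hs' : (0 : ℝ) < s := by exact_mod_cast hs
  have h1 := iidList_toOuterMeasure_mean_add_le q (fun a => if a ∈ S then (1 : ℝ) else 0)
    (fun a => by split_ifs <;> simp) hτ0 hτ s
  have h2 := iidList_toOuterMeasure_mean_add_le q (fun a => -(if a ∈ S then (1 : ℝ) else 0))
    (fun a => by split_ifs <;> simp) hτ0 hτ s
  simp only [mul_neg, Finset.sum_neg_distrib] at h2
  rw [sum_toReal_mul_ite] at h1 h2
  rw [two_mul, ENNReal.ofReal_add (Real.exp_nonneg _) (Real.exp_nonneg _)]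
  refine le_trans ?_ (add_le_add h1 h2)
  refine le_trans (MeasureTheory.measure_mono ?_) (MeasureTheory.measure_union_le _ _)
  intro l hl
  have hneg : (l.map fun a => -(if a ∈ S then (1 : ℝ) else 0)).sum =
      -(l.map fun a => if a ∈ S then (1 : ℝ) else 0).sum := by
    rw [List.sum_neg, List.map_map]; rfl
  simp only [Set.mem_ofPred_eq, Set.mem_union, hneg]
  have he : (l.map fun a => if a ∈ S then (1 : ℝ) else 0).sum = s * freq S s l := by
    rw [freq]; field_simp
  rw [he, ← mul_neg, mul_le_mul_iff_right₀ hs', mul_le_mul_iff_right₀ hs']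
  simp only [Set.mem_ofPred_eq, not_le, lt_abs] at hl
  rcases hl with h | h
  · left; linarith
  · right; linarith

end Concentration

/-! ### From couplings to permutations -/

section Matching

variable {n : ℕ}

/-- A doubly substochastic matrix is dominated by a doubly stochastic one. -/
lemma exists_doublyStochastic_ge {w : Matrix (Fin n) (Fin n) ℝ} (h0 : ∀ i j, 0 ≤ w i j)
    (hr : ∀ i, ∑ j, w i j ≤ 1) (hc : ∀ j, ∑ i, w i j ≤ 1) :
    ∃ D ∈ doublyStochastic ℝ (Fin n), ∀ i j, w i j ≤ D i j := by
  set r : Fin n → ℝ := fun i => 1 - ∑ j, w i j with hrdef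
  set c : Fin n → ℝ := fun j => 1 - ∑ i, w i j with hcdef
  have hr0 : ∀ i, 0 ≤ r i := fun i => sub_nonneg.2 (hr i)
  have hc0 : ∀ j, 0 ≤ c j := fun j => sub_nonneg.2 (hc j)
  have hrc : ∑ i, r i = ∑ j, c j := by
    simp only [hrdef, hcdef, Finset.sum_sub_distrib]
    rw [Finset.sum_comm]
  rcases (Finset.sum_nonneg fun i _ => hr0 i : 0 ≤ ∑ i, r i).eq_or_lt with hz | hp
  · refine ⟨w, mem_doublyStochastic_iff_sum.2 ⟨h0, fun i => ?_, fun j => ?_⟩, fun i j => le_rfl⟩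
    · have := (Finset.sum_eq_zero_iff_of_nonneg fun i _ => hr0 i).1 hz.symm i (Finset.mem_univ i)
      simp only [hrdef] at this; linarith
    · have := (Finset.sum_eq_zero_iff_of_nonneg fun j _ => hc0 j).1 (hrc ▸ hz.symm) j
        (Finset.mem_univ j)
      simp only [hcdef] at this; linarith
  -- The rank-one correction has exactly the missing row and column sums, whose totals agree by
  -- `hrc`.
  · refine ⟨Matrix.of fun i j => w i j + r i * c j / ∑ i, r i, mem_doublyStochastic_iff_sum.2
      ⟨fun i j => ?_, fun i => ?_, fun j => ?_⟩, fun i j => ?_⟩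
    · have := h0 i j; have := hr0 i; have := hc0 j
      simp only [Matrix.of_apply]; positivity
    · simp only [Matrix.of_apply, Finset.sum_add_distrib]
      rw [← Finset.sum_div, ← Finset.mul_sum, ← hrc, mul_div_cancel_right₀ _ hp.ne']
      simp [hrdef]
    · simp only [Matrix.of_apply, Finset.sum_add_distrib]
      rw [← Finset.sum_div, ← Finset.sum_mul, mul_comm, mul_div_cancel_right₀ _ hp.ne']
      simp [hcdef]
    · have := hr0 i; have := hc0 j
      simp only [Matrix.of_apply, le_add_iff_nonneg_right]; positivity

/-- Some permutation has at least the weight of a given doubly substochastic matrix. -/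
lemma exists_perm_sum_ge {w : Matrix (Fin n) (Fin n) ℝ} (h0 : ∀ i j, 0 ≤ w i j)
    (hr : ∀ i, ∑ j, w i j ≤ 1) (hc : ∀ j, ∑ i, w i j ≤ 1) (g : Fin n → Fin n → ℝ)
    (hg : ∀ i j, 0 ≤ g i j) :
    ∃ σ : Equiv.Perm (Fin n), ∑ i, ∑ j, w i j * g i j ≤ ∑ i, g i (σ i) := by
  obtain ⟨D, hD, hwD⟩ := exists_doublyStochastic_ge h0 hr hc
  -- By Birkhoff, the dominating matrix is a convex combination of permutation matrices; some
  -- permutation does at least as well as the average.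
  obtain ⟨v, hv0, hv1, rfl⟩ := exists_eq_sum_perm_of_mem_doublyStochastic hD
  by_contra! hcon
  have hle : ∑ i, ∑ j, w i j * g i j ≤ ∑ σ, v σ * ∑ i, g i (σ i) := by
    calc _ ≤ ∑ i, ∑ j, (∑ σ, v σ • Equiv.Perm.permMatrix ℝ σ) i j * g i j :=
          Finset.sum_le_sum fun i _ => Finset.sum_le_sum fun j _ =>
            mul_le_mul_of_nonneg_right (hwD i j) (hg i j)
      _ = ∑ i, ∑ j, ∑ σ : Equiv.Perm (Fin n), v σ * (if σ i = j then g i j else 0) := by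
          refine Finset.sum_congr rfl fun i _ => Finset.sum_congr rfl fun j _ => ?_
          rw [Matrix.sum_apply, Finset.sum_mul]
          refine Finset.sum_congr rfl fun σ _ => ?_
          simp [PEquiv.toMatrix_apply, eq_comm]
      _ = ∑ σ, v σ * ∑ i, g i (σ i) := by
          simp_rw [Finset.sum_comm (s := Finset.univ (α := Fin n))
            (t := Finset.univ (α := Equiv.Perm (Fin n)))]
          refine Finset.sum_congr rfl fun σ _ => ?_
          simp [Finset.mul_sum]
  have hlt : ∑ σ, v σ * ∑ i, g i (σ i) < ∑ σ, v σ * ∑ i, ∑ j, w i j * g i j := by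
    refine Finset.sum_lt_sum (fun σ _ => mul_le_mul_of_nonneg_left (hcon σ).le (hv0 σ)) ?_
    obtain ⟨σ, -, hσ⟩ := Finset.exists_ne_zero_of_sum_ne_zero (hv1.trans_ne one_ne_zero)
    exact ⟨σ, Finset.mem_univ _, mul_lt_mul_of_pos_left (hcon σ) ((hv0 σ).lt_of_ne' hσ)⟩
  rw [← Finset.sum_mul, hv1, one_mul] at hlt
  exact absurd hle (not_le.2 hlt)

lemma tvDist_eq_one_sub (μ ν : PMF (Fin n)) :
    tvDist μ ν = 1 - ∑ i, min (μ i).toReal (ν i).toReal := by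
  have h : ∀ i, |(μ i).toReal - (ν i).toReal| =
      (μ i).toReal + (ν i).toReal - 2 * min (μ i).toReal (ν i).toReal := fun i => by
    rcases le_total (μ i).toReal (ν i).toReal with h | h
    · rw [min_eq_left h, abs_of_nonpos (by linarith)]; ring
    · rw [min_eq_right h, abs_of_nonneg (by linarith)]; ring
  simp only [tvDist, h, Finset.sum_sub_distrib, Finset.sum_add_distrib, sum_toReal_eq_one,
    ← Finset.mul_sum]
  ring

lemma map_perm_apply (ν : PMF (Fin n)) (σ : Equiv.Perm (Fin n)) (i : Fin n) :
    (ν.map σ) i = ν (σ.symm i) := by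
  rw [PMF.map_apply, tsum_eq_single (σ.symm i)]
  · simp
  · intro j hj
    rw [if_neg]
    rintro rfl
    simp at hj

/-- If two distributions have a partial coupling which only pairs elements whose probabilities
agree up to a factor `exp η`, then they are close up to a permutation. -/
lemma exists_perm_tvDist_le (μ ν : PMF (Fin n)) (π : Fin n → Fin n → ℝ)
    (h0 : ∀ i j, 0 ≤ π i j) (hr : ∀ i, ∑ j, π i j ≤ (μ i).toReal)
    (hc : ∀ j, ∑ i, π i j ≤ (ν j).toReal) {η : ℝ}
    (hπ : ∀ i j, π i j ≠ 0 → (μ i).toReal ≤ Real.exp η * (ν j).toReal ∧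
      (ν j).toReal ≤ Real.exp η * (μ i).toReal) (hη : 0 ≤ η) :
    ∃ σ : Equiv.Perm (Fin n), tvDist μ (ν.map σ) ≤ 1 - Real.exp (-η) * ∑ i, ∑ j, π i j := by
  set M : Fin n → Fin n → ℝ := fun i j => max (μ i).toReal (ν j).toReal with hM
  have hM0 : ∀ i j, 0 ≤ M i j := fun i j => le_max_of_le_left ENNReal.toReal_nonneg
  have hle1 : ∀ i j, π i j ≤ (μ i).toReal := fun i j =>
    (Finset.single_le_sum (fun j _ => h0 i j) (Finset.mem_univ j)).trans (hr i)
  have hle2 : ∀ i j, π i j ≤ (ν j).toReal := fun i j =>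
    (Finset.single_le_sum (fun i _ => h0 i j) (Finset.mem_univ i)).trans (hc j)
  -- Dividing by the larger probability makes all row and column sums at most 1. Against the weight
  -- `min`, the overlap of the two distributions, a nonzero entry of `π` still keeps the factor `min
  -- / max ≥ exp (-η)`.
  obtain ⟨σ, hσ⟩ := exists_perm_sum_ge (w := fun i j => π i j / M i j)
    (fun i j => div_nonneg (h0 i j) (hM0 i j))
    (fun i => by
      rcases (ENNReal.toReal_nonneg (a := μ i)).eq_or_lt with h | h
      · rw [Finset.sum_eq_zero]
        · exact zero_le_one
        · intro j _
          rw [le_antisymm ((hle1 i j).trans_eq h.symm) (h0 i j), zero_div]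
      · calc ∑ j, π i j / M i j ≤ ∑ j, π i j / (μ i).toReal :=
            Finset.sum_le_sum fun j _ => div_le_div_of_nonneg_left (h0 i j) h (le_max_left _ _)
          _ ≤ 1 := by rw [← Finset.sum_div]; exact (div_le_one h).2 (hr i))
    (fun j => by
      rcases (ENNReal.toReal_nonneg (a := ν j)).eq_or_lt with h | h
      · rw [Finset.sum_eq_zero]
        · exact zero_le_one
        · intro i _
          rw [le_antisymm ((hle2 i j).trans_eq h.symm) (h0 i j), zero_div]
      · calc ∑ i, π i j / M i j ≤ ∑ i, π i j / (ν j).toReal :=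
            Finset.sum_le_sum fun i _ => div_le_div_of_nonneg_left (h0 i j) h (le_max_right _ _)
          _ ≤ 1 := by rw [← Finset.sum_div]; exact (div_le_one h).2 (hc j))
    (fun i j => min (μ i).toReal (ν j).toReal)
    (fun i j => le_min ENNReal.toReal_nonneg ENNReal.toReal_nonneg)
  refine ⟨σ.symm, ?_⟩
  rw [tvDist_eq_one_sub]
  simp only [map_perm_apply, Equiv.symm_symm]
  refine sub_le_sub_left (le_trans ?_ hσ) _
  rw [Finset.mul_sum]
  refine Finset.sum_le_sum fun i _ => ?_
  rw [Finset.mul_sum]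
  refine Finset.sum_le_sum fun j _ => ?_
  rcases (h0 i j).eq_or_lt with h | h
  · simp [← h]
  obtain ⟨ha, hb⟩ := hπ i j h.ne'
  have hMpos : 0 < M i j := h.trans_le ((hle1 i j).trans (le_max_left _ _))
  rw [div_mul_eq_mul_div, le_div_iff₀ hMpos, mul_comm (Real.exp _), mul_assoc]
  refine mul_le_mul_of_nonneg_left ?_ h.le
  have he : 1 ≤ Real.exp η := Real.one_le_exp hη
  rw [Real.exp_neg, inv_mul_le_iff₀ (Real.exp_pos _)]
  have hμ0 : 0 ≤ (μ i).toReal := ENNReal.toReal_nonneg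
  have hν0 : 0 ≤ (ν j).toReal := ENNReal.toReal_nonneg
  rw [mul_min_of_nonneg _ _ (Real.exp_pos _).le]
  exact max_le (le_min (le_mul_of_one_le_left hμ0 he) ha) (le_min hb (le_mul_of_one_le_left hν0 he))

end Matching

/-! ### Couplings through random labels -/

section JointLaws

variable {n : ℕ} {β : Type} [Fintype β]

/-- Restricting the joint law to the pairs with an accurate label only lowers the marginals and
loses mass at most `κ`. Positivity of `μ i` is recorded since `Real.log 0 = 0` could make a label
look accurate. -/
lemma exists_restricted_weight (μ : PMF (Fin n)) (J : PMF (Fin n × β))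
    (hJ : J.map Prod.fst = μ) (v : β → ℝ) {η κ : ℝ}
    (hκ : (J.toOuterMeasure {x | ¬ |Real.log (μ x.1).toReal - v x.2| ≤ η}).toReal ≤ κ) :
    ∃ a : Fin n → β → ℝ, (∀ i b, 0 ≤ a i b) ∧ (∀ i, ∑ b, a i b ≤ (μ i).toReal) ∧
      (∀ b, ∑ i, a i b ≤ ((J.map Prod.snd) b).toReal) ∧ 1 - κ ≤ ∑ b, ∑ i, a i b ∧
      ∀ i b, a i b ≠ 0 → 0 < (μ i).toReal ∧ |Real.log (μ i).toReal - v b| ≤ η := by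
  classical
  have hfst : ∀ i, (μ i).toReal = ∑ b, (J (i, b)).toReal := fun i => by
    rw [← hJ, PMF.map_apply, tsum_fintype, Fintype.sum_prod_type, Finset.sum_eq_single i,
      ← ENNReal.toReal_sum fun b _ => J.apply_ne_top _]
    · simp
    · intro j _ hj; simp [hj.symm]
    · simp
  have hsnd : ∀ b, ((J.map Prod.snd) b).toReal = ∑ i, (J (i, b)).toReal := fun b => by
    rw [PMF.map_apply, tsum_fintype, Fintype.sum_prod_type_right, Finset.sum_eq_single b,
      ← ENNReal.toReal_sum fun b _ => J.apply_ne_top _]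
    · simp
    · intro j _ hj; simp [hj.symm]
    · simp
  refine ⟨fun i b => if |Real.log (μ i).toReal - v b| ≤ η then (J (i, b)).toReal else 0,
    fun i b => ?_, fun i => ?_, fun b => ?_, ?_, fun i b h => ?_⟩
  · dsimp only; split_ifs <;> simp
  · rw [hfst]
    exact Finset.sum_le_sum fun b _ => by dsimp only; split_ifs <;> simp
  · rw [hsnd]
    exact Finset.sum_le_sum fun b _ => by dsimp only; split_ifs <;> simp
  · have h1 := sum_toReal_eq_one J
    rw [← sum_toReal_mul_ite] at hκ
    rw [Fintype.sum_prod_type_right] at h1 hκ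
    simp only [Set.mem_ofPred_eq] at hκ
    rw [sub_le_iff_le_add, ← h1]
    refine le_trans (le_of_eq ?_) (add_le_add_right hκ _)
    rw [← Finset.sum_add_distrib]
    refine Finset.sum_congr rfl fun b _ => ?_
    rw [← Finset.sum_add_distrib]
    refine Finset.sum_congr rfl fun i _ => ?_
    dsimp only
    by_cases h : |Real.log (μ i).toReal - v b| ≤ η
    · rw [if_pos h, if_neg (not_not.2 h), mul_zero, add_zero]
    · rw [if_neg h, if_pos h, mul_one, zero_add]
  · simp only [ne_eq, ite_eq_right_iff, Classical.not_imp] at h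
    refine ⟨?_, h.1⟩
    rw [hfst]
    exact (ENNReal.toReal_nonneg.lt_of_ne' h.2).trans_le
      (Finset.single_le_sum (f := fun b => (J (i, b)).toReal)
        (fun b _ => ENNReal.toReal_nonneg) (Finset.mem_univ b))

lemma le_exp_mul_of_abs_log_sub_le {x y c : ℝ} (hx : 0 < x) (hy : 0 < y)
    (h : Real.log x - Real.log y ≤ c) : x ≤ Real.exp c * y := by
  calc x = Real.exp (Real.log x) := (Real.exp_log hx).symm
    _ ≤ Real.exp (c + Real.log y) := Real.exp_le_exp.2 (by linarith)
    _ = _ := by rw [Real.exp_add, Real.exp_log hy]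

/-- If labels are attached at random to the elements of two distributions, so that a label
nearly determines the probability of the element, and the laws of the labels are close, then the
two distributions are close up to a permutation. -/
lemma exists_perm_tvDist_le_of_labels (μ ν : PMF (Fin n)) (J J' : PMF (Fin n × β))
    (hJ : J.map Prod.fst = μ) (hJ' : J'.map Prod.fst = ν) (v : β → ℝ) {η κ ρ : ℝ} (hη : 0 ≤ η)
    (hκ : (J.toOuterMeasure {x | ¬ |Real.log (μ x.1).toReal - v x.2| ≤ η}).toReal ≤ κ)
    (hκ' : (J'.toOuterMeasure {x | ¬ |Real.log (ν x.1).toReal - v x.2| ≤ η}).toReal ≤ κ)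
    (hρ : ∑ b, |((J.map Prod.snd) b).toReal - ((J'.map Prod.snd) b).toReal| ≤ 2 * ρ) :
    ∃ σ : Equiv.Perm (Fin n), tvDist μ (ν.map σ) ≤ 2 * η + 2 * κ + ρ := by
  obtain ⟨a, ha0, har, hac, hat, hag⟩ := exists_restricted_weight μ J hJ v hκ
  obtain ⟨a', ha0', har', hac', hat', hag'⟩ := exists_restricted_weight ν J' hJ' v hκ'
  set O : β → ℝ := fun b => ((J.map Prod.snd) b).toReal with hO
  set O' : β → ℝ := fun b => ((J'.map Prod.snd) b).toReal with hO'
  set M : β → ℝ := fun b => max (O b) (O' b) with hM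
  have hM0 : ∀ b, 0 ≤ M b := fun b => le_max_of_le_left ENNReal.toReal_nonneg
  have hA : ∀ b, ∑ i, a i b ≤ M b := fun b => (hac b).trans (le_max_left _ _)
  have hA' : ∀ b, ∑ i, a' i b ≤ M b := fun b => (hac' b).trans (le_max_right _ _)
  -- Given the label, the two elements are chosen independently. Normalising by the larger label
  -- probability keeps both marginals below `μ` and `ν`.
  set π : Fin n → Fin n → ℝ := fun i j => ∑ b, a i b * a' j b / M b with hπ
  have hπ0 : ∀ i j, 0 ≤ π i j := fun i j => Finset.sum_nonneg fun b _ =>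
    div_nonneg (mul_nonneg (ha0 i b) (ha0' j b)) (hM0 b)
  have hrow : ∀ i, ∑ j, π i j ≤ (μ i).toReal := fun i => by
    refine le_trans ?_ (har i)
    rw [hπ, Finset.sum_comm]
    refine Finset.sum_le_sum fun b _ => ?_
    rw [← Finset.sum_div, ← Finset.mul_sum, mul_div_assoc]
    exact mul_le_of_le_one_right (ha0 i b) (div_le_one_of_le₀ (hA' b) (hM0 b))
  have hcol : ∀ j, ∑ i, π i j ≤ (ν j).toReal := fun j => by
    refine le_trans ?_ (har' j)
    rw [hπ, Finset.sum_comm]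
    refine Finset.sum_le_sum fun b _ => ?_
    rw [← Finset.sum_div, ← Finset.sum_mul, mul_comm, mul_div_assoc]
    exact mul_le_of_le_one_right (ha0' j b) (div_le_one_of_le₀ (hA b) (hM0 b))
  have htot : 1 - 2 * κ - ρ ≤ ∑ i, ∑ j, π i j := by
    have hsumM : ∑ b, M b ≤ 1 + ρ := by
      have h : ∀ b, M b = (O b + O' b + |O b - O' b|) / 2 := fun b => by
        rcases le_total (O b) (O' b) with h | h
        · simp only [hM]; rw [max_eq_right h, abs_of_nonpos (by linarith)]; ring
        · simp only [hM]; rw [max_eq_left h, abs_of_nonneg (by linarith)]; ring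
      simp only [h, ← Finset.sum_div, Finset.sum_add_distrib, hO, hO', sum_toReal_eq_one]
      linarith
    calc 1 - 2 * κ - ρ ≤ ∑ b, (∑ i, a i b + ∑ i, a' i b - M b) := by
          rw [Finset.sum_sub_distrib, Finset.sum_add_distrib]; linarith
      _ ≤ ∑ b, (∑ i, a i b) * (∑ j, a' j b) / M b := by
          refine Finset.sum_le_sum fun b _ => ?_
          rcases (hM0 b).eq_or_lt with h | h
          · have h1 := hA b; have h2 := hA' b
            rw [← h] at h1 h2 ⊢
            rw [div_zero]; linarith
          · rw [le_div_iff₀ h]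
            nlinarith [mul_nonneg (sub_nonneg.2 (hA b)) (sub_nonneg.2 (hA' b))]
      _ = ∑ i, ∑ j, π i j := by
          simp only [hπ, Finset.sum_mul_sum, Finset.sum_div]
          rw [Finset.sum_comm]
          exact Finset.sum_congr rfl fun i _ => Finset.sum_comm
  have hle1 : ∑ i, ∑ j, π i j ≤ 1 :=
    (Finset.sum_le_sum fun i _ => hrow i).trans_eq (sum_toReal_eq_one μ)
  -- Both logarithms lie within `η` of the same `v b`, hence within `2 * η` of each other.
  obtain ⟨σ, hσ⟩ := exists_perm_tvDist_le μ ν π hπ0 hrow hcol (η := 2 * η) (fun i j hij => by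
    obtain ⟨b, -, hb⟩ := Finset.exists_ne_zero_of_sum_ne_zero hij
    have hb1 : a i b ≠ 0 := fun h => hb (by rw [h, zero_mul, zero_div])
    have hb2 : a' j b ≠ 0 := fun h => hb (by rw [h, mul_zero, zero_div])
    obtain ⟨h1, h2⟩ := hag i b hb1
    obtain ⟨h3, h4⟩ := hag' j b hb2
    rw [abs_le] at h2 h4
    exact ⟨le_exp_mul_of_abs_log_sub_le h1 h3 (by linarith),
      le_exp_mul_of_abs_log_sub_le h3 h1 (by linarith)⟩) (by linarith)
  refine ⟨σ, hσ.trans ?_⟩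
  have hexp : 1 - 2 * η ≤ Real.exp (-(2 * η)) := by
    linarith [Real.add_one_le_exp (-(2 * η))]
  have hpos : 0 ≤ ∑ i, ∑ j, π i j := Finset.sum_nonneg fun i _ => Finset.sum_nonneg fun j _ => hπ0 i j
  nlinarith [mul_le_mul_of_nonneg_right hexp hpos]

end JointLaws

/-! ### Estimating the probability of a random element -/

section Dyadic

variable {n : ℕ}

/-- The `c`-th dyadic block of length `2 ^ k`. -/
def dyadicClass (n k c : ℕ) : Finset (Fin n) :=
  Finset.univ.filter fun j => (j : ℕ) / 2 ^ k = c

@[simp] lemma mem_dyadicClass {k c : ℕ} {j : Fin n} :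
    j ∈ dyadicClass n k c ↔ (j : ℕ) / 2 ^ k = c := by
  simp [dyadicClass]

/-- The dyadic block of length `2 ^ k` around `i`. -/
def dyadicBlock (k : ℕ) (i : Fin n) : {A : Finset (Fin n) // A.Nonempty} :=
  ⟨dyadicClass n k ((i : ℕ) / 2 ^ k), ⟨i, by simp⟩⟩

/-- The probability of the `c`-th dyadic block of length `2 ^ k`. -/
def dyadicMass (μ : PMF (Fin n)) (k c : ℕ) : ℝ :=
  ∑ j ∈ dyadicClass n k c, (μ j).toReal

/-- The probability of the dyadic block of length `2 ^ k` around `i`. -/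
def blockMass (μ : PMF (Fin n)) (k : ℕ) (i : Fin n) : ℝ := dyadicMass μ k ((i : ℕ) / 2 ^ k)

lemma dyadicMass_nonneg (μ : PMF (Fin n)) (k c : ℕ) : 0 ≤ dyadicMass μ k c :=
  Finset.sum_nonneg fun _ _ => ENNReal.toReal_nonneg

lemma le_blockMass (μ : PMF (Fin n)) (k : ℕ) (i : Fin n) : (μ i).toReal ≤ blockMass μ k i :=
  Finset.single_le_sum (f := fun j => (μ j).toReal) (fun _ _ => ENNReal.toReal_nonneg)
    (mem_dyadicClass.2 rfl)

lemma blockMass_zero (μ : PMF (Fin n)) (i : Fin n) : blockMass μ 0 i = (μ i).toReal := by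
  simp only [blockMass, dyadicMass, pow_zero, Nat.div_one]
  rw [Finset.sum_eq_single i] <;> simp +contextual [Fin.ext_iff]

lemma blockMass_of_le (μ : PMF (Fin n)) {k : ℕ} (hk : n ≤ 2 ^ k) (i : Fin n) :
    blockMass μ k i = 1 := by
  rw [← sum_toReal_eq_one μ, blockMass, dyadicMass]
  congr 1
  ext j
  simp [Nat.div_eq_of_lt (j.2.trans_le hk), Nat.div_eq_of_lt (i.2.trans_le hk)]

lemma dyadicBlock_subset (k : ℕ) (i : Fin n) :
    (dyadicBlock k i).1 ⊆ (dyadicBlock (k + 1) i).1 := by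
  intro j hj
  simp only [dyadicBlock, mem_dyadicClass] at hj ⊢
  rw [pow_succ, ← Nat.div_div_eq_div_mul, ← Nat.div_div_eq_div_mul, hj]

lemma condSample_apply (μ : PMF (Fin n)) (A : {A : Finset (Fin n) // A.Nonempty})
    (hA : 0 < ∑ j ∈ A.1, (μ j).toReal) (a : Fin n) :
    (condSample μ A a).toReal =
      (if a ∈ A.1 then (μ a).toReal else 0) / ∑ j ∈ A.1, (μ j).toReal := by
  classical
  obtain ⟨b, hb, hb0⟩ := Finset.exists_ne_zero_of_sum_ne_zero hA.ne'
  have h : ∃ a ∈ (A.1 : Set (Fin n)), a ∈ μ.support := by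
    refine ⟨b, hb, fun h => hb0 ?_⟩
    rw [h, ENNReal.toReal_zero]
  rw [condSample, dif_pos h, PMF.filter_apply, ENNReal.toReal_mul, ENNReal.toReal_inv,
    div_eq_mul_inv]
  congr 1
  · by_cases ha : a ∈ A.1 <;> simp [ha]
  · rw [tsum_fintype, ENNReal.toReal_sum]
    · congr 1
      rw [← Finset.sum_filter_add_sum_filter_not Finset.univ (· ∈ A.1)]
      simp only [Finset.filter_univ_mem]
      rw [add_eq_left.2]
      · exact Finset.sum_congr rfl fun j hj => by simp [hj]
      · refine Finset.sum_eq_zero fun j hj => ?_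
        simp only [Finset.mem_filter, Finset.mem_univ, true_and] at hj
        simp [hj]
    · intro j _
      by_cases hj : j ∈ A.1 <;> simp [hj, μ.apply_ne_top]

lemma condSample_of_eq_univ (μ : PMF (Fin n)) (A : {A : Finset (Fin n) // A.Nonempty})
    (hA : A.1 = Finset.univ) : condSample μ A = μ := by
  have h1 : ∑ j ∈ A.1, (μ j).toReal = 1 := by rw [hA, sum_toReal_eq_one]
  refine PMF.ext fun a => ?_
  rw [← ENNReal.toReal_eq_toReal_iff' (PMF.apply_ne_top _ _) (PMF.apply_ne_top _ _),
    condSample_apply μ A (h1 ▸ zero_lt_one), h1, hA]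
  simp

lemma condSample_dyadicBlock (μ : PMF (Fin n)) (k : ℕ) (i : Fin n)
    (h : 0 < blockMass μ (k + 1) i) :
    ((condSample μ (dyadicBlock (k + 1) i)).toOuterMeasure ((dyadicBlock k i).1 : Set _)).toReal =
      blockMass μ k i / blockMass μ (k + 1) i := by
  classical
  rw [← sum_toReal_mul_ite]
  simp only [condSample_apply μ (dyadicBlock (k + 1) i) h, Finset.mem_coe, mul_ite, mul_one,
    mul_zero]
  rw [← Finset.sum_filter, Finset.filter_univ_mem, ← Finset.sum_div]
  congr 1
  exact Finset.sum_congr rfl fun j hj => if_pos (dyadicBlock_subset k i hj)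

/-- The average of the inverse of the conditional probability of a child block is at most the
number of children. -/
lemma sum_mul_blockMass_div_le (μ : PMF (Fin n)) (k : ℕ) :
    ∑ i, (μ i).toReal * (blockMass μ (k + 1) i / blockMass μ k i) ≤ 2 := by
  -- Within one block the terms sum to 1, or to 0 if the block has mass 0 (division by zero).
  have hone : ∀ c : ℕ, ∑ i ∈ dyadicClass n k c, (μ i).toReal / blockMass μ k i ≤ 1 := by
    intro c
    calc _ = ∑ i ∈ dyadicClass n k c, (μ i).toReal / dyadicMass μ k c :=
          Finset.sum_congr rfl fun i hi => by
            rw [blockMass, mem_dyadicClass.1 hi]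
      _ ≤ 1 := by
          rw [← Finset.sum_div]
          exact div_self_le_one _
  have hinner : ∀ j : Fin n, ∑ i ∈ dyadicClass n (k + 1) (j / 2 ^ (k + 1)),
      (μ i).toReal / blockMass μ k i ≤ 2 := by
    intro j
    set q := (j : ℕ) / 2 ^ (k + 1)
    have hnn : ∀ i, 0 ≤ (μ i).toReal / blockMass μ k i := fun i =>
      div_nonneg ENNReal.toReal_nonneg (dyadicMass_nonneg _ _ _)
    calc _ ≤ ∑ i ∈ dyadicClass n k (2 * q) ∪ dyadicClass n k (2 * q + 1),
            (μ i).toReal / blockMass μ k i := by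
          refine Finset.sum_le_sum_of_subset_of_nonneg (fun i hi => ?_) fun i _ _ => hnn i
          simp only [Finset.mem_union, mem_dyadicClass] at hi ⊢
          rw [pow_succ, ← Nat.div_div_eq_div_mul] at hi
          omega
      _ ≤ _ := by
          rw [← Finset.sum_union_inter]
          exact le_add_of_nonneg_right (Finset.sum_nonneg fun i _ => hnn i)
      _ ≤ 1 + 1 := add_le_add (hone _) (hone _)
      _ = 2 := by norm_num
  -- Write the parent's mass as a sum over `j` and exchange the sums: each `j` sees only the at most
  -- two children of its own parent block.
  calc ∑ i, (μ i).toReal * (blockMass μ (k + 1) i / blockMass μ k i)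
      = ∑ i : Fin n, ∑ j : Fin n, (μ j).toReal * (if (i : ℕ) / 2 ^ (k + 1) = (j : ℕ) / 2 ^ (k + 1) then
          (μ i).toReal / blockMass μ k i else 0) := by
        refine Finset.sum_congr rfl fun i _ => ?_
        simp only [mul_ite, mul_zero, eq_comm (a := (i : ℕ) / 2 ^ (k + 1))]
        rw [← Finset.sum_filter, ← Finset.sum_mul, blockMass, dyadicMass, dyadicClass]
        ring
    _ ≤ ∑ j, (μ j).toReal * 2 := by
        rw [Finset.sum_comm]
        refine Finset.sum_le_sum fun j _ => ?_
        rw [← Finset.mul_sum, ← Finset.sum_filter]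
        exact mul_le_mul_of_nonneg_left (hinner j) ENNReal.toReal_nonneg
    _ = 2 := by rw [← Finset.sum_mul, sum_toReal_eq_one, one_mul]

/-- All dyadic blocks around `i` below level `K` have conditional probability at least `γ`. -/
def HeavyPath (μ : PMF (Fin n)) (γ : ℝ) (K : ℕ) (i : Fin n) : Prop :=
  0 < (μ i).toReal ∧ ∀ k < K, γ ≤ blockMass μ k i / blockMass μ (k + 1) i

/-- Markov's inequality on each level: at a light block the inverse conditional probability exceeds
`γ⁻¹`, while its mean is at most 2. Then a union bound over `K` levels. -/
lemma toOuterMeasure_not_heavyPath_le (μ : PMF (Fin n)) {γ : ℝ} (hγ : 0 < γ) (K : ℕ) :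
    μ.toOuterMeasure {i | HeavyPath μ γ K i}ᶜ ≤ ENNReal.ofReal (K * (2 * γ)) := by
  classical
  refine (ENNReal.le_ofReal_iff_toReal_le
    (ne_top_of_le_ne_top ENNReal.one_ne_top (toOuterMeasure_le_one _ _)) (by positivity)).2 ?_
  rw [← sum_toReal_mul_ite]
  calc _ ≤ ∑ i, ∑ k ∈ Finset.range K,
        γ * ((μ i).toReal * (blockMass μ (k + 1) i / blockMass μ k i)) := by
        refine Finset.sum_le_sum fun i _ => ?_
        have hnn : ∀ k ∈ Finset.range K,
            0 ≤ γ * ((μ i).toReal * (blockMass μ (k + 1) i / blockMass μ k i)) := fun k _ =>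
          mul_nonneg hγ.le (mul_nonneg ENNReal.toReal_nonneg
            (div_nonneg (dyadicMass_nonneg _ _ _) (dyadicMass_nonneg _ _ _)))
        rcases (ENNReal.toReal_nonneg (a := μ i)).eq_or_lt with h0 | h0
        · rw [← h0, zero_mul]
          rw [← h0] at hnn
          exact Finset.sum_nonneg hnn
        split_ifs with h
        · obtain ⟨k, hk, hlt⟩ : ∃ k < K, blockMass μ k i / blockMass μ (k + 1) i < γ := by
            by_contra! hcon
            exact h ⟨h0, hcon⟩
          refine le_trans ?_ (Finset.single_le_sum hnn (Finset.mem_range.2 hk))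
          have h1 : 0 < blockMass μ k i := h0.trans_le (le_blockMass _ _ _)
          have h2 : 0 < blockMass μ (k + 1) i := h0.trans_le (le_blockMass _ _ _)
          rw [mul_left_comm]
          refine mul_le_mul_of_nonneg_left ?_ h0.le
          rw [div_lt_iff₀ h2] at hlt
          rw [← mul_div_assoc, le_div_iff₀ h1]
          linarith
        · rw [mul_zero]
          exact Finset.sum_nonneg hnn
    _ = ∑ k ∈ Finset.range K,
        γ * ∑ i, (μ i).toReal * (blockMass μ (k + 1) i / blockMass μ k i) := by
        rw [Finset.sum_comm]
        simp only [Finset.mul_sum]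
    _ ≤ ∑ k ∈ Finset.range K, γ * 2 := Finset.sum_le_sum fun k _ =>
        mul_le_mul_of_nonneg_left (sum_mul_blockMass_div_le μ k) hγ.le
    _ = _ := by simp [mul_comm]

/-- The conditional probabilities telescope. At the top level this bounds `μ i` below by `γ ^ K`,
which is why finitely many labels suffice. -/
lemma pow_mul_blockMass_le (μ : PMF (Fin n)) {γ : ℝ} (hγ : 0 < γ) {K : ℕ} {i : Fin n}
    (h : HeavyPath μ γ K i) : γ ^ K * blockMass μ K i ≤ (μ i).toReal := by
  have hle : ∀ k ≤ K, γ ^ k * blockMass μ k i ≤ (μ i).toReal := by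
    intro k
    induction k with
    | zero => intro _; rw [pow_zero, one_mul, blockMass_zero]
    | succ k ih =>
      intro hk
      refine le_trans ?_ (ih (by omega))
      rw [pow_succ, mul_assoc]
      exact mul_le_mul_of_nonneg_left
        ((le_div_iff₀ (h.1.trans_le (le_blockMass _ _ _))).1 (h.2 k hk)) (by positivity)
  exact hle K le_rfl

end Dyadic

/-! ### Estimates along the dyadic path, and labelled samples -/

section Estimation

variable {n : ℕ}

/-- `x` is positive and agrees with `y` up to a factor `exp c`. -/
def LogClose (c y x : ℝ) : Prop := 0 < x ∧ |Real.log x - Real.log y| ≤ c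

lemma LogClose.mul {c c' x x' y y' : ℝ} (h : LogClose c y x) (h' : LogClose c' y' x')
    (hy : 0 < y) (hy' : 0 < y') : LogClose (c + c') (y * y') (x * x') := by
  refine ⟨mul_pos h.1 h'.1, ?_⟩
  rw [Real.log_mul h.1.ne' h'.1.ne', Real.log_mul hy.ne' hy'.ne', add_sub_add_comm]
  exact (abs_add_le _ _).trans (add_le_add h.2 h'.2)

lemma logClose_of_abs_sub_le {c x y : ℝ} (hc0 : 0 ≤ c) (hc : c ≤ 1) (hy : 0 < y)
    (h : |x - y| ≤ y * (c / 2)) : LogClose c y x := by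
  rw [abs_le] at h
  have hx : y * (1 - c / 2) ≤ x := by linarith
  have hx0 : 0 < x := lt_of_lt_of_le (mul_pos hy (by linarith)) hx
  refine ⟨hx0, ?_⟩
  have hr : 0 < x / y := div_pos hx0 hy
  rw [← Real.log_div hx0.ne' hy.ne', abs_le]
  constructor
  · rw [Real.le_log_iff_exp_le hr, le_div_iff₀ hy, Real.exp_neg, inv_mul_le_iff₀ (Real.exp_pos _)]
    have h1 : 1 + c ≤ Real.exp c := by linarith [Real.add_one_le_exp c]
    -- `(1 + c) * (1 - c / 2) = 1 + c * (1 - c) / 2`, at least 1 because `c ≤ 1`.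
    calc y ≤ (1 + c) * (y * (1 - c / 2)) := by nlinarith [mul_nonneg hy.le hc0]
      _ ≤ Real.exp c * x := mul_le_mul h1 hx (mul_nonneg hy.le (by linarith)) (Real.exp_pos _).le
  · refine (Real.log_le_sub_one_of_pos hr).trans ?_
    rw [tsub_le_iff_right, div_le_iff₀ hy]
    nlinarith [mul_nonneg hy.le hc0]

/-- Estimate the conditional probability of a block in its parent block by `r` queries. -/
def estimateLevel (r k : ℕ) (i : Fin n) : QueryTree n ℝ :=
  ((QueryTree.ask (dyadicBlock (k + 1) i) QueryTree.ret).replicate r).bind fun l =>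
    QueryTree.ret (freq ((dyadicBlock k i).1 : Set (Fin n)) r l)

/-- Estimate the conditional probability of `i` in its dyadic block of length `2 ^ k`. -/
def estimate (r : ℕ) (i : Fin n) : ℕ → QueryTree n ℝ
  | 0 => QueryTree.ret 1
  | k + 1 => (estimate r i k).bind fun x => (estimateLevel r k i).bind fun y =>
      QueryTree.ret (x * y)

lemma estimateLevel_depthLE (r k : ℕ) (i : Fin n) : (estimateLevel r k i).DepthLE r := by
  have h : (QueryTree.ask (dyadicBlock (k + 1) i) QueryTree.ret).DepthLE 1 := fun j => trivial
  have h' := (h.replicate r).bind (t := 0) (f := fun l =>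
    QueryTree.ret (freq ((dyadicBlock k i).1 : Set (Fin n)) r l)) fun l => QueryTree.depthLE_ret _ _
  rwa [mul_one] at h'

lemma estimate_depthLE (r : ℕ) (i : Fin n) (k : ℕ) : (estimate r i k).DepthLE (k * r) := by
  induction k with
  | zero => trivial
  | succ k ih =>
    rw [show (k + 1) * r = k * r + (r + 0) by ring]
    exact ih.bind fun x => (estimateLevel_depthLE r k i).bind fun y => QueryTree.depthLE_ret _ _

lemma estimateLevel_law (μ : PMF (Fin n)) (r k : ℕ) (i : Fin n) :
    (estimateLevel r k i).law μ = (iidList (condSample μ (dyadicBlock (k + 1) i)) r).map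
      (freq ((dyadicBlock k i).1 : Set (Fin n)) r) := by
  have h : (QueryTree.ask (dyadicBlock (k + 1) i) QueryTree.ret).law μ =
      condSample μ (dyadicBlock (k + 1) i) := PMF.bind_pure _
  rw [estimateLevel, QueryTree.law_bind, QueryTree.law_replicate, h]
  rfl

/-- As the true conditional probability is at least `γ`, additive accuracy `γ * (c / 2)` is relative
accuracy `c / 2`. -/
lemma estimateLevel_error (μ : PMF (Fin n)) {r k : ℕ} (hr : 0 < r) {i : Fin n}
    {γ c : ℝ} (hγ : 0 < γ) (hi : 0 < blockMass μ (k + 1) i)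
    (hγi : γ ≤ blockMass μ k i / blockMass μ (k + 1) i) (hc0 : 0 ≤ c) (hc : c ≤ 1) :
    ((estimateLevel r k i).law μ).toOuterMeasure
        {x | LogClose c (blockMass μ k i / blockMass μ (k + 1) i) x}ᶜ ≤
      ENNReal.ofReal (2 * Real.exp (-(r * (γ * (c / 2)) ^ 2 / 4))) := by
  have h := condSample_dyadicBlock μ k i hi
  have hle1 : γ ≤ 1 := by
    refine hγi.trans ?_
    rw [← h, ← ENNReal.toReal_one]
    exact ENNReal.toReal_mono ENNReal.one_ne_top (toOuterMeasure_le_one _ _)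
  rw [estimateLevel_law, PMF.toOuterMeasure_map_apply]
  refine le_trans (MeasureTheory.measure_mono ?_) (iidList_freq_le _
    ((dyadicBlock k i).1 : Set (Fin n)) (τ := γ * (c / 2)) (by positivity) (mul_le_one₀ hle1 (by positivity) (by linarith)) hr)
  intro l hl hcon
  rw [h] at hcon
  exact hl (logClose_of_abs_sub_le hc0 hc (hγ.trans_le hγi)
    (hcon.trans (mul_le_mul_of_nonneg_right hγi (by positivity))))

/-- Logarithmic errors and failure probabilities both add up over the levels, while the true factors
telescope. -/
lemma estimate_error (μ : PMF (Fin n)) {r K : ℕ} (hr : 0 < r) {i : Fin n}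
    {γ c : ℝ} (hγ : 0 < γ) (hi : HeavyPath μ γ K i) (hc0 : 0 ≤ c) (hc : c ≤ 1) :
    ((estimate r i K).law μ).toOuterMeasure
        {x | LogClose (K * c) ((μ i).toReal / blockMass μ K i) x}ᶜ ≤
      ENNReal.ofReal (K * (2 * Real.exp (-(r * (γ * (c / 2)) ^ 2 / 4)))) := by
  have hpos : ∀ k, 0 < blockMass μ k i := fun k => hi.1.trans_le (le_blockMass _ _ _)
  have key : ∀ k ≤ K, ((estimate r i k).law μ).toOuterMeasure
        {x | LogClose (k * c) ((μ i).toReal / blockMass μ k i) x}ᶜ ≤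
      ENNReal.ofReal (k * (2 * Real.exp (-(r * (γ * (c / 2)) ^ 2 / 4)))) := by
    intro k
    induction k with
    | zero =>
      intro _
      rw [estimate, QueryTree.law_ret, PMF.toOuterMeasure_pure_apply, if_neg]
      · exact zero_le
      · rw [Set.mem_compl_iff, not_not, Set.mem_ofPred_eq, blockMass_zero, div_self hi.1.ne']
        simp [LogClose]
    | succ k ih =>
      intro hk
      rw [estimate, QueryTree.law_bind]
      refine (toOuterMeasure_bind_le _ _ _ _
        (ENNReal.ofReal (2 * Real.exp (-(r * (γ * (c / 2)) ^ 2 / 4)))) fun x hx => ?_).trans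
        ((add_le_add_left (ih (by omega)) _).trans_eq ?_)
      · rw [QueryTree.law_bind]
        refine (toOuterMeasure_bind_le _ _ _ _ 0 fun y hy => ?_).trans
          ((add_zero _).trans_le (estimateLevel_error μ hr hγ (hpos (k + 1)) (hi.2 k hk) hc0 hc))
        rw [QueryTree.law_ret, PMF.toOuterMeasure_pure_apply, if_neg]
        rw [Set.mem_compl_iff, not_not, Set.mem_ofPred_eq]
        have h := LogClose.mul hx hy (div_pos hi.1 (hpos k)) (div_pos (hpos k) (hpos (k + 1)))
        rw [div_mul_div_cancel₀ (hpos k).ne'] at h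
        rwa [Nat.cast_succ, add_mul, one_mul]
      · rw [← ENNReal.ofReal_add (by positivity) (by positivity)]
        congr 1
        push_cast
        ring
  exact key K le_rfl

/-- The label of an estimate `x`: the integral part of `-log x / η`, cut off at `L`. -/
def label (L : ℕ) (η x : ℝ) : Fin (L + 1) :=
  ⟨min L ⌊-Real.log x / η⌋₊, Nat.lt_succ_of_le (min_le_left _ _)⟩

lemma abs_log_sub_label_le {L : ℕ} {η x y : ℝ} (hη : 0 < η) (hy1 : y ≤ 1)
    (hy0 : 0 < y) (hyL : -Real.log y ≤ η * (L - 1)) (h : LogClose η y x) :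
    |Real.log y - -(η * (label L η x : ℕ))| ≤ 2 * η := by
  obtain ⟨h1, h2⟩ := abs_le.1 h.2
  have hlog : Real.log y ≤ 0 := Real.log_nonpos hy0.le hy1
  have hlabel : ((label L η x : Fin (L + 1)) : ℕ) = ⌊-Real.log x / η⌋₊ := by
    -- The cutoff is inactive: `hyL` uses `L - 1`, leaving one `η` of room for the error of the
    -- estimate.
    refine min_eq_right (Nat.floor_le_of_le ?_)
    rw [div_le_iff₀ hη]
    linarith
  rw [hlabel, abs_le]
  have hlt : -Real.log x < η * (⌊-Real.log x / η⌋₊ + 1) := by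
    rw [mul_comm, ← div_lt_iff₀ hη]
    exact Nat.lt_floor_add_one _
  constructor
  · linarith
  · rcases le_total 0 (-Real.log x / η) with h0 | h0
    · have hle : η * ⌊-Real.log x / η⌋₊ ≤ -Real.log x := by
        rw [mul_comm, ← le_div_iff₀ hη]
        exact Nat.floor_le h0
      linarith
    · rw [Nat.floor_of_nonpos h0, Nat.cast_zero, mul_zero]
      linarith

/-- Draw an element and attach the label of an estimate of its probability to it. -/
def labelledSample [NeZero n] (r K L : ℕ) (η : ℝ) : QueryTree n (Fin n × Fin (L + 1)) :=
  (QueryTree.ask ⟨Finset.univ, Finset.univ_nonempty⟩ QueryTree.ret).bind fun i =>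
    (estimate r i K).bind fun x => QueryTree.ret (i, label L η x)

variable [NeZero n]

lemma labelledSample_depthLE (r K L : ℕ) (η : ℝ) :
    (labelledSample r K L η : QueryTree n _).DepthLE (1 + K * r) := by
  refine QueryTree.DepthLE.bind (fun j => trivial) fun i => ?_
  rw [← add_zero (K * r)]
  exact (estimate_depthLE r i K).bind fun x => QueryTree.depthLE_ret _ _

lemma labelledSample_law (μ : PMF (Fin n)) (r K L : ℕ) (η : ℝ) :
    (labelledSample r K L η).law μ =
      μ.bind fun i => ((estimate r i K).law μ).map fun x => (i, label L η x) := by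
  have h : (QueryTree.ask ⟨Finset.univ, Finset.univ_nonempty⟩ QueryTree.ret).law μ = μ :=
    (PMF.bind_pure _).trans (condSample_of_eq_univ μ _ rfl)
  rw [labelledSample, QueryTree.law_bind, h]
  refine congrArg _ (funext fun i => ?_)
  rw [QueryTree.law_bind]
  rfl

lemma labelledSample_map_fst (μ : PMF (Fin n)) (r K L : ℕ) (η : ℝ) :
    ((labelledSample r K L η).law μ).map Prod.fst = μ := by
  rw [labelledSample_law, PMF.map_bind]
  conv_rhs => rw [← PMF.bind_pure μ]
  refine congrArg _ (funext fun i => ?_)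
  rw [PMF.map_comp]
  exact PMF.map_const _ _

/-- A label is bad only if the drawn element has a light path or some level is misestimated; these
give the two summands. -/
lemma labelledSample_error (μ : PMF (Fin n)) {r K L : ℕ} (hr : 0 < r) (hK : n ≤ 2 ^ K)
    {γ c η : ℝ} (hγ : 0 < γ) (hc0 : 0 ≤ c) (hc : c ≤ 1) (hη : 0 < η) (hKc : K * c ≤ η)
    (hL : K * γ⁻¹ ≤ η * (L - 1)) :
    ((labelledSample r K L η).law μ).toOuterMeasure
        {x | ¬ |Real.log (μ x.1).toReal - -(η * (x.2 : ℕ))| ≤ 2 * η} ≤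
      ENNReal.ofReal
        (K * (2 * γ) + K * (2 * Real.exp (-(r * (γ * (c / 2)) ^ 2 / 4)))) := by
  rw [labelledSample_law, ENNReal.ofReal_add (by positivity) (by positivity)]
  refine (toOuterMeasure_bind_le _ _ _ _ _ fun i hi => ?_).trans
    (add_le_add_left (toOuterMeasure_not_heavyPath_le μ hγ K) _)
  rw [PMF.toOuterMeasure_map_apply]
  refine le_trans (MeasureTheory.measure_mono ?_) (estimate_error μ hr hγ hi hc0 hc)
  intro x hx hcon
  refine hx ?_
  rw [Set.mem_ofPred_eq, blockMass_of_le μ hK, div_one] at hcon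
  have hpow := pow_mul_blockMass_le μ hγ hi
  rw [blockMass_of_le μ hK, mul_one] at hpow
  refine abs_log_sub_label_le hη ?_ hi.1 ?_ ⟨hcon.1, hcon.2.trans hKc⟩
  · rw [← blockMass_of_le μ hK i]
    exact le_blockMass _ _ _
  · refine le_trans ?_ hL
    have h1 := Real.log_le_log (by positivity) hpow
    rw [Real.log_pow] at h1
    -- A crude bound, but it keeps the number of labels polynomial.
    have h2 : -Real.log γ ≤ γ⁻¹ := by
      rw [← Real.log_inv]
      exact (Real.log_le_sub_one_of_pos (inv_pos.2 hγ)).trans (by linarith)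
    calc -Real.log (μ i).toReal ≤ K * -Real.log γ := by linarith
      _ ≤ _ := mul_le_mul_of_nonneg_left h2 (Nat.cast_nonneg K)

end Estimation

/-! ### The tester -/

lemma toOuterMeasure_snd_eq {α β : Type} (J : PMF (α × β)) (b : β) :
    J.toOuterMeasure {x | x.2 = b} = (J.map Prod.snd) b := by
  rw [← PMF.toOuterMeasure_apply_singleton, PMF.toOuterMeasure_map_apply]
  rfl

/-- The empirical law of the labels of independent samples is close to the law of the label. -/
lemma iidList_snd_freq_error {α β : Type} [Fintype α] [Fintype β] (J : PMF (α × β)) {τ : ℝ}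
    (hτ0 : 0 ≤ τ) (hτ : τ ≤ 1) {s : ℕ} (hs : 0 < s) :
    (iidList J s).toOuterMeasure
        {l | ∀ b, |freq {x : α × β | x.2 = b} s l - ((J.map Prod.snd) b).toReal| ≤ τ}ᶜ ≤
      ENNReal.ofReal (Fintype.card β * (2 * Real.exp (-(s * τ ^ 2 / 4)))) := by
  calc _ ≤ (iidList J s).toOuterMeasure
        (⋃ b, {l | ¬ |freq {x : α × β | x.2 = b} s l -
          (J.toOuterMeasure {x | x.2 = b}).toReal| ≤ τ}) := by
        refine MeasureTheory.measure_mono fun l hl => ?_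
        simp only [Set.mem_compl_iff, Set.mem_ofPred_eq, not_forall] at hl
        obtain ⟨b, hb⟩ := hl
        refine Set.mem_iUnion.2 ⟨b, ?_⟩
        rw [Set.mem_ofPred_eq, toOuterMeasure_snd_eq]
        exact hb
    _ ≤ ∑ b : β, ENNReal.ofReal (2 * Real.exp (-(s * τ ^ 2 / 4))) :=
        (MeasureTheory.measure_iUnion_fintype_le _ _).trans
          (Finset.sum_le_sum fun b _ => iidList_freq_le J _ hτ0 hτ hs)
    _ = _ := by
        rw [Finset.sum_const, nsmul_eq_mul, Finset.card_univ, ENNReal.ofReal_mul (Nat.cast_nonneg _),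
          ENNReal.ofReal_natCast]

lemma one_sub_le_toReal_of_subset {α : Type} (q : PMF α) {G S : Set α} (h : G ⊆ S) {δ : ℝ}
    (hδ : 0 ≤ δ) (hG : q.toOuterMeasure Gᶜ ≤ ENNReal.ofReal δ) :
    1 - δ ≤ (q.toOuterMeasure S).toReal := by
  have h1 : 1 ≤ q.toOuterMeasure S + ENNReal.ofReal δ :=
    (tsub_le_iff_right.1 (one_sub_toOuterMeasure_compl_le q G)).trans
      (add_le_add (MeasureTheory.measure_mono h) hG)
  have hS := ne_top_of_le_ne_top ENNReal.one_ne_top (toOuterMeasure_le_one q S)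
  have h2 := ENNReal.toReal_mono (ENNReal.add_ne_top.2 ⟨hS, ENNReal.ofReal_ne_top⟩) h1
  rw [ENNReal.toReal_add hS ENNReal.ofReal_ne_top, ENNReal.toReal_ofReal hδ,
    ENNReal.toReal_one] at h2
  linarith

/-- The number of labels. -/
def numLabels {R : Type} [CommSemiring R] (K W : R) : R := K ^ 2 * W ^ 2 + 2

/-- The number of labelled samples. -/
def numRounds {R : Type} [CommSemiring R] (K W D : R) : R :=
  4 * W ^ 2 * numLabels K W ^ 2 * (2 * numLabels K W + D)

/-- The number of queries per level of the dyadic tree. -/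
def numRepetitions {R : Type} [CommSemiring R] (K W : R) : R := 32 * K ^ 5 * W ^ 5

/-- The number of queries of the tester. -/
def numQueries {R : Type} [CommSemiring R] (K W D : R) : R :=
  numRounds K W D * (1 + K * numRepetitions K W)

section Tester

variable {n : ℕ} [NeZero n]

/-- The labelled sample with the parameters used by the tester. -/
def testSample (n K W : ℕ) [NeZero n] : QueryTree n (Fin n × Fin (K ^ 2 * W ^ 2 + 1 + 1)) :=
  labelledSample (numRepetitions K W) K (K ^ 2 * W ^ 2 + 1) (1 / W)

/-- With `γ = c = 1 / (K * W)` and `η = 1 / W`, both side conditions of `labelledSample_error` are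
equalities, and `numRepetitions` makes the Chernoff exponent `-(2 * K * W)`. Light paths cost `2 /
W`, misestimates at most `1 / W`. -/
lemma testSample_error (μ : PMF (Fin n)) {K W : ℕ} (hK0 : 1 ≤ K) (hW0 : 1 ≤ W)
    (hK : n ≤ 2 ^ K) :
    (((testSample n K W).law μ).toOuterMeasure
        {x | ¬ |Real.log (μ x.1).toReal - -(1 / (W : ℝ) * (x.2 : ℕ))| ≤ 2 * (1 / W)}).toReal ≤
      3 / W := by
  have hKr : (1 : ℝ) ≤ K := by exact_mod_cast hK0
  have hWr : (1 : ℝ) ≤ W := by exact_mod_cast hW0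
  have hKW : (1 : ℝ) ≤ K * W := one_le_mul_of_one_le_of_one_le hKr hWr
  have hc : (1 / (K * W) : ℝ) ≤ 1 := (div_le_one (by linarith)).2 hKW
  refine ENNReal.toReal_le_of_le_ofReal (by positivity) ((labelledSample_error μ
    (r := numRepetitions K W) (L := K ^ 2 * W ^ 2 + 1) (γ := 1 / (K * W)) (c := 1 / (K * W))
    (η := 1 / W) (by unfold numRepetitions; positivity) hK (by positivity) (by positivity) hc
    (by positivity) (le_of_eq (by field_simp)) (le_of_eq (by push_cast; field_simp; ring))).trans
    (ENNReal.ofReal_le_ofReal ?_))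
  have hexp : -((numRepetitions K W : ℕ) * (1 / (K * W) * (1 / (K * W) / 2)) ^ 2 / 4 : ℝ) =
      -(2 * (K * W)) := by
    simp only [numRepetitions]
    push_cast
    field_simp
    norm_num
  have h1 : Real.exp (-(2 * (K * W))) ≤ 1 / (2 * (K * W)) := by
    rw [Real.exp_neg, ← one_div]
    exact one_div_le_one_div_of_le (by positivity)
      (by linarith [Real.add_one_le_exp (2 * (K * W : ℝ))])
  rw [hexp]
  calc (K * (2 * (1 / (K * W))) + K * (2 * Real.exp (-(2 * (K * W)))) : ℝ)
      ≤ K * (2 * (1 / (K * W))) + K * (2 * (1 / (2 * (K * W)))) := by gcongr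
    _ = 3 / W := by field_simp; norm_num

/-- Distributions with similar laws of labels are close up to a permutation. -/
lemma exists_perm_tvDist_lt (μ ν : PMF (Fin n)) {K W : ℕ} (hK0 : 1 ≤ K) (hW0 : 1 ≤ W)
    (hK : n ≤ 2 ^ K)
    (h : ∀ b, |((((testSample n K W).law μ).map Prod.snd) b).toReal -
      ((((testSample n K W).law ν).map Prod.snd) b).toReal| ≤
        2 * (1 / (W * numLabels (K : ℝ) W))) :
    ∃ σ : Equiv.Perm (Fin n), tvDist μ (ν.map σ) < 16 / W := by
  have hWr : (0 : ℝ) < W := by exact_mod_cast hW0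
  have hN : (0 : ℝ) < numLabels (K : ℝ) W := by unfold numLabels; positivity
  obtain ⟨σ, hσ⟩ := exists_perm_tvDist_le_of_labels μ ν ((testSample n K W).law μ)
    ((testSample n K W).law ν) (labelledSample_map_fst _ _ _ _ _)
    (labelledSample_map_fst _ _ _ _ _) (fun b => -(1 / (W : ℝ) * (b : ℕ)))
    (η := 2 * (1 / W)) (ρ := 1 / W) (by positivity) (testSample_error μ hK0 hW0 hK)
    (testSample_error ν hK0 hW0 hK) (by
      refine (Finset.sum_le_sum fun b _ => h b).trans (le_of_eq ?_)
      have hcard : ((Fintype.card (Fin (K ^ 2 * W ^ 2 + 1 + 1)) : ℕ) : ℝ) =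
          numLabels (K : ℝ) W := by
        rw [Fintype.card_fin, numLabels]; push_cast; ring
      rw [Finset.sum_const, nsmul_eq_mul, Finset.card_univ, hcard]
      field_simp)
  refine ⟨σ, hσ.trans_lt ?_⟩
  -- Rounding, bad labels and the distance of the label laws, in this order; 16 leaves slack for a
  -- strict inequality.
  rw [show 2 * (2 * (1 / W)) + 2 * (3 / W) + 1 / W = (11 / W : ℝ) by ring]
  exact div_lt_div_of_pos_right (by norm_num) hWr

/-- The label frequencies in the list of samples are compatible with a distribution `μ`. -/
def Compatible (K W D : ℕ) (μ : PMF (Fin n))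
    (l : List (Fin n × Fin (K ^ 2 * W ^ 2 + 1 + 1))) : Prop :=
  ∀ b, |freq {x | x.2 = b} (numRounds K W D) l -
    ((((testSample n K W).law μ).map Prod.snd) b).toReal| ≤ 1 / (W * numLabels (K : ℝ) W)

/-- `numRounds` makes the Chernoff exponent `-(2 * N + D)` for `N` labels. The part `2 * N` absorbs
the union-bound factor `2 * N`. -/
lemma compatible_error (μ : PMF (Fin n)) {K W D : ℕ} (hW0 : 1 ≤ W) :
    (iidList ((testSample n K W).law μ) (numRounds K W D)).toOuterMeasure
      {l | Compatible K W D μ l}ᶜ ≤ ENNReal.ofReal (Real.exp (-D)) := by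
  have hWr : (1 : ℝ) ≤ W := by exact_mod_cast hW0
  have hN : (1 : ℝ) ≤ numLabels (K : ℝ) W := by
    unfold numLabels
    have : (0 : ℝ) ≤ K ^ 2 * W ^ 2 := by positivity
    linarith
  have hτ : 1 / (W * numLabels (K : ℝ) W) ≤ 1 :=
    (div_le_one (by positivity)).2 (one_le_mul_of_one_le_of_one_le hWr hN)
  refine (iidList_snd_freq_error ((testSample n K W).law μ) (by positivity) hτ
    (s := numRounds K W D) (by unfold numRounds numLabels; positivity)).trans
    (ENNReal.ofReal_le_ofReal ?_)
  have hcard : ((Fintype.card (Fin (K ^ 2 * W ^ 2 + 1 + 1)) : ℕ) : ℝ) = numLabels (K : ℝ) W := by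
    rw [Fintype.card_fin, numLabels]; push_cast; ring
  have hcast : ((numRounds K W D : ℕ) : ℝ) = numRounds (K : ℝ) W D := by
    simp only [numRounds, numLabels]; push_cast; ring
  rw [hcard, hcast]
  set N := numLabels (K : ℝ) W with hNdef
  have hexp : -(numRounds (K : ℝ) W D * (1 / (W * N)) ^ 2 / 4) = -(2 * N) + -D := by
    simp only [numRounds, ← hNdef]
    field_simp
    ring
  have h1 : 2 * N * Real.exp (-(2 * N)) ≤ 1 := by
    rw [Real.exp_neg, ← div_eq_mul_inv]
    exact (div_le_one (Real.exp_pos _)).2 (by linarith [Real.add_one_le_exp (2 * N)])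
  rw [hexp, Real.exp_add, ← mul_assoc, ← mul_assoc, mul_comm N 2]
  exact mul_le_of_le_one_left (Real.exp_pos _).le h1

open Classical in
/-- Accept if the label frequencies are compatible with a member of the property. -/
def testTree (S : Set (PMF (Fin n))) (K W D : ℕ) : QueryTree n Bool :=
  ((testSample n K W).replicate (numRounds K W D)).bind fun l =>
    QueryTree.ret (decide (∃ ν ∈ S, Compatible K W D ν l))

lemma testTree_depthLE (S : Set (PMF (Fin n))) (K W D : ℕ) :
    (testTree S K W D).DepthLE (numQueries K W D) :=
  QueryTree.DepthLE.bind (t := 0) ((labelledSample_depthLE _ _ _ _).replicate _)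
    fun _ => QueryTree.depthLE_ret _ _

open Classical in
lemma testTree_law_apply (S : Set (PMF (Fin n))) (K W D : ℕ) (μ : PMF (Fin n)) (d : Bool) :
    (testTree S K W D).law μ d =
      (iidList ((testSample n K W).law μ) (numRounds K W D)).toOuterMeasure
        {l | decide (∃ ν ∈ S, Compatible K W D ν l) = d} := by
  have h : (testTree S K W D).law μ =
      (iidList ((testSample n K W).law μ) (numRounds K W D)).map
        fun l => decide (∃ ν ∈ S, Compatible K W D ν l) := by
    rw [testTree, QueryTree.law_bind, QueryTree.law_replicate]
    rfl
  rw [h, ← PMF.toOuterMeasure_apply_singleton, PMF.toOuterMeasure_map_apply]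
  rfl

/-- One good event serves both cases: the samples are compatible with `μ` itself. A member of the
property is then its own witness; a witness `ν` for a far `μ` would, by the triangle inequality on
label laws, have a relabelling too close to `μ`. -/
lemma exists_algorithm (P : DistProperty) (hP : IsLabelInvariant P) {ε δ : ℝ} {K W D : ℕ}
    (hK0 : 1 ≤ K) (hW0 : 1 ≤ W) (hK : n ≤ 2 ^ K) (hW : 16 / W ≤ ε) (hD : Real.exp (-D) ≤ δ) :
    ∃ T : AdaptiveAlgorithm n, ∀ μ : PMF (Fin n),
      (μ ∈ P n → 1 - δ ≤ (T.output μ (numQueries K W D) true).toReal) ∧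
      (IsFar ε μ (P n) → 1 - δ ≤ (T.output μ (numQueries K W D) false).toReal) := by
  classical
  refine ⟨(testTree (P n) K W D).toAlgorithm ⟨Finset.univ, Finset.univ_nonempty⟩, fun μ => ?_⟩
  have hδ : 0 ≤ δ := (Real.exp_pos _).le.trans hD
  have hG := (compatible_error μ (K := K) (D := D) hW0).trans (ENNReal.ofReal_le_ofReal hD)
  rw [QueryTree.output_toAlgorithm _ _ (testTree_depthLE _ _ _ _)]
  refine ⟨fun hμ => ?_, fun hfar => ?_⟩ <;> rw [testTree_law_apply] <;>
    refine one_sub_le_toReal_of_subset _ (fun l hl => ?_) hδ hG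
  · exact decide_eq_true ⟨μ, hμ, hl⟩
  · refine decide_eq_false ?_
    rintro ⟨ν, hν, hνl⟩
    obtain ⟨σ, hσ⟩ := exists_perm_tvDist_lt μ ν hK0 hW0 hK fun b => by
      have h1 := hl b
      have h2 := hνl b
      rw [abs_le] at h1 h2 ⊢
      constructor <;> linarith
    exact absurd (hfar _ (hP n σ ν hν)) (not_le.2 (hσ.trans_le hW))

end Tester

/-! ### The query complexity -/

/-- One formula serves as query count in `ℕ`, as real bound and as polynomial; casts and evaluation
commute with it. -/
lemma map_numQueries {R S : Type} [CommSemiring R] [CommSemiring S] (f : R →+* S) (K W D : R) :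
    f (numQueries K W D) = numQueries (f K) (f W) (f D) := by
  simp only [numQueries, numRounds, numRepetitions, numLabels, map_mul, map_add, map_pow, map_one,
    map_ofNat]

lemma numQueries_mono {K K' W W' D D' : ℝ} (hK0 : 0 ≤ K) (hW0 : 0 ≤ W) (hD0 : 0 ≤ D)
    (hK : K ≤ K') (hW : W ≤ W') (hD : D ≤ D') : numQueries K W D ≤ numQueries K' W' D' := by
  simp only [numQueries, numRounds, numRepetitions, numLabels]
  have hK' := hK0.trans hK
  have hW' := hW0.trans hW
  have hD' := hD0.trans hD
  gcongr

lemma clog_le {n : ℕ} (hn : 1 ≤ n) : (Nat.clog 2 n : ℝ) ≤ 2 * Real.log n + 1 := by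
  have hlog : 0 ≤ Real.log n := Real.log_natCast_nonneg n
  rcases Nat.eq_zero_or_pos (Nat.clog 2 n) with h | h
  · rw [h, Nat.cast_zero]; linarith
  have hn2 : 1 < n := by
    by_contra hcon
    rw [show n = 1 by omega] at h
    simp at h
  have hlt : 2 ^ (Nat.clog 2 n - 1) < n := Nat.pow_pred_clog_lt_self one_lt_two hn2
  have h1 : Real.log (2 ^ (Nat.clog 2 n - 1) : ℝ) ≤ Real.log n :=
    Real.log_le_log (by positivity) (by exact_mod_cast hlt.le)
  rw [Real.log_pow, Nat.cast_sub h, Nat.cast_one] at h1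
  have h2 : (0 : ℝ) ≤ (Nat.clog 2 n : ℝ) - 1 := by
    rw [sub_nonneg]; exact_mod_cast h
  -- The factor 2 comes from `log 2 > 1 / 2`.
  nlinarith [Real.log_two_gt_d9]

end CondTesting

end

theorem mainTheorem2 :
    ∃ p : MvPolynomial (Fin 3) ℝ,
      ∀ P : CondTesting.DistProperty, CondTesting.IsLabelInvariant P →
        ∃ t : ℝ → ℝ → ℕ → ℕ,
          (∀ (ε δ : ℝ) (n : ℕ), 0 < ε → 0 < δ → 1 ≤ n →
            (t ε δ n : ℝ) ≤ MvPolynomial.eval ![Real.log n, 1 / ε, Real.log (1 / δ)] p) ∧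
          CondTesting.HasAdaptiveTester P t := by
  -- `K` has an extra 1 so that it is positive for `n = 1`. The third argument is squared since `log
  -- (1 / δ)` is negative for `δ > 1`, while the bound on `D` must stay nonnegative.
  refine ⟨CondTesting.numQueries (2 * MvPolynomial.X 0 + 2) (16 * (MvPolynomial.X 1 + 1))
    (MvPolynomial.X 2 ^ 2 + 2), fun P hP => ⟨fun ε δ n => CondTesting.numQueries
      (Nat.clog 2 n + 1) (16 * ⌈1 / ε⌉₊) ⌈Real.log (1 / δ)⌉₊, fun ε δ n hε hδ hn => ?_,
      fun ε δ n hε hδ hn => ?_⟩⟩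
  · rw [CondTesting.map_numQueries, ← Nat.coe_castRingHom, CondTesting.map_numQueries]
    refine CondTesting.numQueries_mono (Nat.cast_nonneg _) (Nat.cast_nonneg _)
      (Nat.cast_nonneg _) ?_ ?_ ?_
    · simp only [Nat.coe_castRingHom, map_add, map_mul, MvPolynomial.eval_X, Matrix.cons_val, map_ofNat]
      push_cast
      linarith [CondTesting.clog_le hn]
    · simp only [Nat.coe_castRingHom, map_add, map_mul, MvPolynomial.eval_X, Matrix.cons_val, map_ofNat, map_one]
      linarith [Nat.ceil_lt_add_one (one_div_nonneg.2 hε.le)]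
    · simp only [Nat.coe_castRingHom, map_add, map_pow, MvPolynomial.eval_X, Matrix.cons_val, map_ofNat]
      rcases le_total 0 (Real.log (1 / δ)) with h | h
      · nlinarith [Nat.ceil_lt_add_one h, sq_nonneg (Real.log (1 / δ) - 1)]
      · rw [Nat.ceil_eq_zero.2 h, Nat.cast_zero]
        positivity
  · have : NeZero n := ⟨by omega⟩
    have hpos : 0 < ⌈1 / ε⌉₊ := Nat.ceil_pos.2 (one_div_pos.2 hε)
    refine CondTesting.exists_algorithm P hP (by omega) (by omega)
      ((Nat.le_pow_clog one_lt_two n).trans (Nat.pow_le_pow_right two_pos (by omega))) ?_ ?_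
    · have h1 : 1 / ε ≤ ⌈1 / ε⌉₊ := Nat.le_ceil _
      have h2 : (0 : ℝ) < ⌈1 / ε⌉₊ := by exact_mod_cast hpos
      rw [div_le_iff₀ hε] at h1
      push_cast
      rw [div_le_iff₀ (by positivity)]
      linarith
    · rw [Real.exp_neg, inv_le_comm₀ (Real.exp_pos _) hδ, ← one_div,
        ← Real.log_le_iff_le_exp (by positivity)]
      exact Nat.le_ceil _
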